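/- All digraphs are finite and simple and are considered up to isomorphism. Let $0\le\alpha<1$. For a digraph $G$ let $A(G)$ be its adjacency matrix, $D(G)$ the diagonal matrix of its outdegrees, $A_\alpha(G)=\alpha D(G)+(1-\alpha)A(G)$, and let the $\alpha$-spectral radius $\rho_\alpha(G)$ be the spectral radius of $A_\alpha(G)$. For natural numbers $m,k$ let $$S_m^k=\Bigl\{\mathbf p\in\mathbb N^k : p_1\ge p_2\ge\dots\ge p_k\ge 2,\ \sum_{i=1}^k p_i=m\Bigr\}.$$ For $\mathbf p\in S_m^k$ let the rose digraph $R(\mathbf p)$ be obtained from disjoint directed cycles of lengths $p_1,\dots,p_k$ by choosing one vertex in each cycle and identifying the chosen vertices, and let $\mathcal R_m^k=\{R(\mathbf p):\mathbf p\in S_m^k\}$. Write $\mathbf p\preceq\mathbf q$ ($\mathbf p$ is majorized by $\mathbf q$) if $\sum_i p_i=\sum_i q_i$ and, for every $j\le k$, the sum of the $j$ smallest entries of $\mathbf q$ is at most the sum of the $j$ smallest entries of $\mathbf p$. (1) If $\mathbf p,\mathbf q\in S_m^k$, $\mathbf p\preceq\mathbf q$ and $\mathbf p\ne\mathbf q$,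 then $\rho_\alpha(R(\mathbf p))<\rho_\alpha(R(\mathbf q))$. (2) Suppose $k\ge1$ and $m\ge 2k$, and write $m=ck+r$ with integers $c$ and $0\le r<k$. Let $\gamma_1=(m-2k+2,2,\dots,2)$ and let $\gamma_2$ be the vector with $r$ entries $c+1$ followed by $k-r$ entries $c$. Then $\gamma_1,\gamma_2\in S_m^k$ are the greatest and the least element of $S_m^k$ with respect to $\preceq$. The digraph $R(\gamma_1)$ is the unique digraph with maximal $\alpha$-spectral radius in $\mathcal R_m^k$, and $R(\gamma_2)$ is the unique digraph with minimal $\alpha$-spectral radius in $\mathcal R_m^k$: for every $G\in\mathcal R_m^k$ one has $\rho_\alpha(R(\gamma_2))\le\rho_\alpha(G)\le\rho_\alpha(R(\gamma_1))$, with equality on the right if and only if $G\cong R(\gamma_1)$, and with equality on the left if and only if $G\cong R(\gamma_2)$. -/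

import Mathlib

noncomputable section

namespace RoseDigraph

/-! ### The matrix `A_α` of a digraph and its spectral radius -/

section AlphaMatrix

variable {V : Type*} [Fintype V]

open Classical in
/-- The outdegree of a vertex. -/
def outDegree (G : Digraph V) (u : V) : ℕ :=
  (Finset.univ.filter fun v => G.Adj u v).card

open Classical in
/-- The adjacency matrix: the entry at `(u, v)` is `1` if there is an arc from `u` to `v`,
and `0` otherwise. -/
def adjMatrix (G : Digraph V) : Matrix V V ℝ :=
  Matrix.of fun u v => if G.Adj u v then 1 else 0

variable [DecidableEq V]

/-- `A_α(G) = α D(G) + (1 - α) A(G)`, where `D(G)` is the diagonal matrix of outdegrees. -/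
def alphaMatrix (α : ℝ) (G : Digraph V) : Matrix V V ℝ :=
  α • Matrix.diagonal (fun u => (outDegree G u : ℝ)) + (1 - α) • adjMatrix G

/-- The `α`-spectral radius `ρ_α(G)`: the largest modulus of a complex eigenvalue of `A_α(G)`. -/
def alphaSpectralRadius (α : ℝ) (G : Digraph V) : ℝ :=
  (spectralRadius ℂ ((alphaMatrix α G).map (algebraMap ℝ ℂ))).toReal

end AlphaMatrix

/-! ### Directed cycles, coalescence and rose digraphs -/

/-- The directed cycle `0 → 1 → ⋯ → n - 1 → 0` with `n` vertices and `n` arcs. -/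
def dirCycle (n : ℕ) : Digraph (Fin n) where
  Adj a b := (b : ℕ) = ((a : ℕ) + 1) % n

section Coalescence

variable {ι : Type*} {V : ι → Type*} [∀ i, DecidableEq (V i)]

/-- The vertices of the coalescence of a family of digraphs at the vertices `v i`: the new
vertex `none`, obtained by identifying all the `v i`, and all the other vertices. -/
abbrev CoalescenceVertex (v : ∀ i, V i) : Type _ :=
  Option (Σ i, {a : V i // a ≠ v i})

/-- The vertex of the coalescence that comes from the vertex `a` of the `i`-th digraph. -/
def toCoalescence (v : ∀ i, V i) (i : ι) (a : V i) : CoalescenceVertex v :=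
  if h : a = v i then none else some ⟨i, a, h⟩

/-- The coalescence of the (disjoint) digraphs `G i` at the vertices `v i`: its arcs are the
images of the arcs of the `G i`. -/
def coalescence (G : ∀ i, Digraph (V i)) (v : ∀ i, V i) : Digraph (CoalescenceVertex v) where
  Adj x y := ∃ i a b, (G i).Adj a b ∧ toCoalescence v i a = x ∧ toCoalescence v i b = y

end Coalescence

/-- `S_m^k`: the partitions of `m` into `k` parts, all at least `2`, in nonincreasing order. -/
def partitionSet (m k : ℕ) : Set (Fin k → ℕ) :=
  {x | Antitone x ∧ (∀ i, 2 ≤ x i) ∧ ∑ i, x i = m}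

variable {m k : ℕ}

/-- The base vertex `0` of the `i`-th cycle of the rose digraph of `p`. -/
def basePoint (p : partitionSet m k) (i : Fin k) : Fin (p.1 i) :=
  ⟨0, lt_of_lt_of_le Nat.zero_lt_two (p.2.2.1 i)⟩

/-- The rose digraph of `p = (p_1, …, p_k)`: the coalescence at one vertex of directed cycles
of lengths `p_1, …, p_k`. -/
def rose (p : partitionSet m k) : Digraph (CoalescenceVertex (basePoint p)) :=
  coalescence (fun i => dirCycle (p.1 i)) (basePoint p)

/-- Isomorphism of digraphs. -/
def IsIsomorphic {V W : Type*} (G : Digraph V) (H : Digraph W) : Prop :=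
  Nonempty (G.Adj ≃r H.Adj)

/-- Membership in the class `R_m^k` of the rose digraphs of the partitions in `S_m^k`; as usual,
digraphs are considered up to isomorphism. -/
def IsRose (m k : ℕ) {V : Type*} (G : Digraph V) : Prop :=
  ∃ p : partitionSet m k, IsIsomorphic G (rose p)

/-! ### Majorization -/

/-- `x` arranged in ascending order. -/
def ascending (x : Fin k → ℕ) : Fin k → ℕ :=
  x ∘ Tuple.sort x

/-- `x` majorizes `y`: every sum of the `j` smallest entries of `x` is at most the sum of the `j`
smallest entries of `y`, and the sums of all entries agree. -/
def Majorizes (x y : Fin k → ℕ) : Prop :=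
  (∀ j, ∑ i ∈ Finset.Iic j, ascending x i ≤ ∑ i ∈ Finset.Iic j, ascending y i) ∧
    ∑ i, x i = ∑ i, y i

/-- The partition `(m - 2k + 2, 2, …, 2)`, that is `(m - 2k) e₁ + 2 e`. -/
def maxPartition (m k : ℕ) (hk : 1 ≤ k) (hm : 2 * k ≤ m) : partitionSet m k :=
  ⟨fun i => (m - 2 * k) * (if (i : ℕ) = 0 then 1 else 0) + 2, by
    refine ⟨fun i j hij => ?_, fun i => by simp, ?_⟩
    · have hij' : (i : ℕ) ≤ j := hij
      by_cases hj : (j : ℕ) = 0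
      · have hi : (i : ℕ) = 0 := by omega
        simp [hi, hj]
      · simp [hj]
    · obtain ⟨l, rfl⟩ : ∃ l, k = l + 1 := ⟨k - 1, by omega⟩
      simp only [Finset.sum_add_distrib, ← Finset.mul_sum, Fin.sum_univ_succ]
      simp
      omega⟩

/-- The most balanced partition `q e + f`, where `m = q k + r` with `0 ≤ r < k` and the first `r`
entries of `f` are `1`, the others `0`. -/
def minPartition (m k : ℕ) (hk : 1 ≤ k) (hm : 2 * k ≤ m) : partitionSet m k :=
  ⟨fun i => m / k + (if (i : ℕ) < m % k then 1 else 0), by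
    refine ⟨fun i j hij => ?_, fun i => ?_, ?_⟩
    · have hij' : (i : ℕ) ≤ j := hij
      dsimp only
      split_ifs <;> omega
    · exact ((Nat.le_div_iff_mul_le hk).2 hm).trans (Nat.le_add_right _ _)
    · have hr : m % k ≤ k := (Nat.mod_lt m hk).le
      have hf : ∑ i : Fin k, (if (i : ℕ) < m % k then 1 else 0) = m % k := by
        rw [Fin.sum_univ_eq_sum_range (fun i => if i < m % k then 1 else 0) k,
          ← Finset.sum_filter]
        have : (Finset.range k).filter (fun i => i < m % k) = Finset.range (m % k) := by
          ext i
          simp only [Finset.mem_filter, Finset.mem_range]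
          omega
        simp [this]
      rw [Finset.sum_add_distrib, hf]
      simpa using Nat.div_add_mod m k⟩

end RoseDigraph

end

/-!
The digraph `R(p)` has an explicit positive eigenvector. Let `t > 0` solve
`(1 - α) ∑ i, t ^ p i + α (k - 1) t = 1 - α`, and give a vertex whose directed
distance to the centre is `d` the weight `t ^ d` (`roseVector`). At the vertices of
outdegree one the eigenvalue equation for
`ρ = α + (1 - α) / t` is immediate, and at the centre it is the equation for `t`
(`alphaMatrix_mulVec_roseVector`). A nonnegative matrix with a positive eigenvector has the
corresponding eigenvalue as its spectral radius (`spectralRadius_eq_of_pos_eigenvector`), so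
`ρ_α(R(p)) = α + (1 - α) / t` (`alphaSpectralRadius_rose`). Irreducibility and the
Perron–Frobenius theorem are not needed.

The left-hand side of the equation is nondecreasing in `t ≥ 0`, and for `k ≥ 2` its root is less
than `1`. For `0 < t < 1` the function `n ↦ t ^ n` is strictly convex, so `∑ i, t ^ p i` increases
strictly with respect to majorization (`sum_pow_lt_of_majorizes`). Hence the root `t` decreases
strictly and `ρ_α` increases strictly (`alphaSpectralRadius_rose_lt`). The extremal digraphs come
from the greatest and the least partition in the majorization order (`maxPartition_majorizes`,
`majorizes_minPartition`), and uniqueness from the strict monotonicity and the invariance of `ρ_α`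
under isomorphism.
-/

namespace RoseDigraph

/-! ### The spectral radius of a nonnegative matrix with a positive eigenvector -/

section PositiveEigenvector

variable {V : Type*} [Fintype V]

theorem mem_spectrum_iff_exists_mulVec [DecidableEq V] {K : Type*} [Field K]
    {M : Matrix V V K} {μ : K} :
    μ ∈ spectrum K M ↔ ∃ v : V → K, v ≠ 0 ∧ M.mulVec v = μ • v := by
  rw [← Matrix.spectrum_toLin', ← Module.End.hasEigenvalue_iff_mem_spectrum]
  constructor
  · intro h
    obtain ⟨v, hv⟩ := h.exists_hasEigenvector
    exact ⟨v, hv.2, by simpa using hv.apply_eq_smul⟩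
  · rintro ⟨v, hv, h⟩
    exact Module.End.hasEigenvalue_of_hasEigenvector (x := v)
      ⟨by rw [Module.End.mem_eigenspace_iff]; simpa using h, hv⟩

/-- Every eigenvalue is bounded by the eigenvalue of the positive eigenvector: compare the two
eigenvectors at an index where the ratio `‖v i‖ / x i` is largest. -/
theorem norm_le_of_pos_eigenvector {M : Matrix V V ℝ} (hM : ∀ i j, 0 ≤ M i j) {x : V → ℝ}
    (hx : ∀ i, 0 < x i) {l : ℝ} (hl : M.mulVec x = l • x) {μ : ℂ} {v : V → ℂ} (hv : v ≠ 0)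
    (hμ : (M.map (algebraMap ℝ ℂ)).mulVec v = μ • v) : ‖μ‖ ≤ l := by
  obtain ⟨i₀, hi₀⟩ := Function.ne_iff.mp hv
  obtain ⟨i, -, hi⟩ := Finset.exists_max_image Finset.univ (fun i => ‖v i‖ / x i) ⟨i₀, by simp⟩
  set c := ‖v i‖ / x i with hc
  have hle (j) : ‖v j‖ ≤ c * x j := (div_le_iff₀ (hx j)).1 (hi j (Finset.mem_univ j))
  have hvi : ‖v i‖ = c * x i := by rw [hc, div_mul_cancel₀ _ (hx i).ne']
  have hc0 : 0 < c :=
    lt_of_lt_of_le (div_pos (norm_pos_iff.2 hi₀) (hx i₀)) (hi i₀ (Finset.mem_univ i₀))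
  have key : ‖μ‖ * (c * x i) ≤ l * (c * x i) := calc
    ‖μ‖ * (c * x i) = ‖∑ j, (M i j : ℂ) * v j‖ := by
      have := congrFun hμ i
      simp only [Matrix.mulVec, dotProduct, Matrix.map_apply, Pi.smul_apply, smul_eq_mul,
        Complex.coe_algebraMap] at this
      rw [this, norm_mul, hvi]
    _ ≤ ∑ j, M i j * (c * x j) := by
      refine (norm_sum_le _ _).trans (Finset.sum_le_sum fun j _ => ?_)
      rw [norm_mul, Complex.norm_real, Real.norm_of_nonneg (hM i j)]
      exact mul_le_mul_of_nonneg_left (hle j) (hM i j)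
    _ = c * ∑ j, M i j * x j := by
      rw [Finset.mul_sum]
      exact Finset.sum_congr rfl fun j _ => by ring
    _ = l * (c * x i) := by
      have := congrFun hl i
      simp only [Matrix.mulVec, dotProduct, Pi.smul_apply, smul_eq_mul] at this
      rw [this]
      ring
  exact le_of_mul_le_mul_right key (mul_pos hc0 (hx i))

theorem spectralRadius_eq_of_pos_eigenvector [DecidableEq V] [Nonempty V] {M : Matrix V V ℝ}
    (hM : ∀ i j, 0 ≤ M i j) {x : V → ℝ} (hx : ∀ i, 0 < x i) {l : ℝ} (hl : M.mulVec x = l • x) :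
    (spectralRadius ℂ (M.map (algebraMap ℝ ℂ))).toReal = l := by
  have hmem : (l : ℂ) ∈ spectrum ℂ (M.map (algebraMap ℝ ℂ)) := by
    refine mem_spectrum_iff_exists_mulVec.2 ⟨fun i => (x i : ℂ), fun h => ?_, ?_⟩
    · obtain ⟨i⟩ := ‹Nonempty V›
      exact (hx i).ne' (by simpa using congrFun h i)
    · ext i
      have := congrArg (fun r : ℝ => (r : ℂ)) (congrFun hl i)
      simpa [Matrix.mulVec, dotProduct] using this
  have hbound : ∀ μ ∈ spectrum ℂ (M.map (algebraMap ℝ ℂ)), ‖μ‖ ≤ l := fun μ hμ => by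
    obtain ⟨v, hv, h⟩ := mem_spectrum_iff_exists_mulVec.1 hμ
    exact norm_le_of_pos_eigenvector hM hx hl hv h
  have hl0 : 0 ≤ l := (norm_nonneg _).trans (hbound _ hmem)
  have : spectralRadius ℂ (M.map (algebraMap ℝ ℂ)) = ENNReal.ofReal l := by
    refine le_antisymm (iSup₂_le fun μ hμ => ?_) ?_
    · rw [← enorm_eq_nnnorm, ← ofReal_norm]
      exact ENNReal.ofReal_le_ofReal (hbound μ hμ)
    · refine le_trans (le_of_eq ?_) (le_iSup₂ (α := ENNReal) (l : ℂ) hmem)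
      rw [← enorm_eq_nnnorm, ← ofReal_norm, Complex.norm_real, Real.norm_of_nonneg hl0]
  rw [this, ENNReal.toReal_ofReal hl0]

end PositiveEigenvector

/-! ### The matrix `A_α`: nonnegativity, action on vectors, isomorphism invariance -/

section AlphaMatrix

variable {V : Type*} [Fintype V] [DecidableEq V]

theorem alphaMatrix_nonneg {α : ℝ} (h0 : 0 ≤ α) (h1 : α ≤ 1) (G : Digraph V) (u v : V) :
    0 ≤ alphaMatrix α G u v := by
  have h1' : 0 ≤ 1 - α := sub_nonneg.2 h1
  simp only [alphaMatrix, adjMatrix, Matrix.add_apply, Matrix.smul_apply, Matrix.diagonal_apply,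
    Matrix.of_apply, smul_eq_mul]
  split_ifs <;> positivity

theorem alphaMatrix_mulVec (α : ℝ) (G : Digraph V) (x : V → ℝ) (u : V) (s : Finset V)
    (hs : ∀ v, v ∈ s ↔ G.Adj u v) :
    (alphaMatrix α G).mulVec x u = α * (s.card * x u) + (1 - α) * ∑ v ∈ s, x v := by
  classical
  have hf : s = Finset.univ.filter fun v => G.Adj u v := by ext v; simp [hs]
  have hd : outDegree G u = s.card := by rw [hf, outDegree]
  rw [alphaMatrix, Matrix.add_mulVec, Pi.add_apply, Matrix.smul_mulVec, Matrix.smul_mulVec,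
    Pi.smul_apply, Pi.smul_apply, Matrix.mulVec_diagonal, hd, smul_eq_mul, smul_eq_mul]
  congr 2
  rw [hf, Finset.sum_filter]
  simp [Matrix.mulVec, dotProduct, adjMatrix]

theorem alphaSpectralRadius_eq_of_isIsomorphic {W : Type*} [Fintype W] [DecidableEq W] (α : ℝ)
    {G : Digraph V} {H : Digraph W} (h : IsIsomorphic G H) :
    alphaSpectralRadius α G = alphaSpectralRadius α H := by
  classical
  obtain ⟨e⟩ := h
  have hd (u : V) : outDegree H (e u) = outDegree G u := by
    refine (Finset.card_bij (fun v _ => e v) ?_ ?_ ?_).symm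
    · intro v hv
      simpa [e.map_rel_iff] using hv
    · intro v _ w _ hvw
      exact e.injective hvw
    · intro w hw
      refine ⟨e.symm w, ?_, e.apply_symm_apply w⟩
      rw [Finset.mem_filter] at hw ⊢
      exact ⟨Finset.mem_univ _, by rw [← e.map_rel_iff, e.apply_symm_apply]; exact hw.2⟩
  have hM : (alphaMatrix α G).map (algebraMap ℝ ℂ) =
      Matrix.reindexAlgEquiv ℂ ℂ e.symm.toEquiv ((alphaMatrix α H).map (algebraMap ℝ ℂ)) := by
    ext u v
    have hdiag : Matrix.diagonal (fun u => (outDegree H u : ℝ)) (e u) (e v) =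
        Matrix.diagonal (fun u => (outDegree G u : ℝ)) u v := by
      simp [Matrix.diagonal_apply, hd]
    have hadj : adjMatrix H (e u) (e v) = adjMatrix G u v := by
      simp [adjMatrix, e.map_rel_iff]
    change algebraMap ℝ ℂ (alphaMatrix α G u v) = algebraMap ℝ ℂ (alphaMatrix α H (e u) (e v))
    simp only [alphaMatrix, Matrix.add_apply, Matrix.smul_apply, hdiag, hadj]
  rw [alphaSpectralRadius, alphaSpectralRadius, hM, spectralRadius, spectralRadius,
    AlgEquiv.spectrum_eq]

end AlphaMatrix

/-! ### Majorization -/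

section Majorization

variable {k : ℕ}

/-- Abel summation: if the partial sums of `d` are nonpositive, replacing the monotone weights `w`
by an upper bound `c` decreases the weighted sum of `d`. -/
theorem mul_sum_le_sum_mul_of_monotone {n : ℕ} {w d : Fin n → ℝ} (hw : Monotone w)
    (hd : ∀ j, ∑ i ∈ Finset.Iic j, d i ≤ 0) {c : ℝ} (hc : ∀ i, w i ≤ c) :
    c * ∑ i, d i ≤ ∑ i, w i * d i := by
  induction n generalizing c with
  | zero => simp
  | succ n ih =>
    have hd0 : ∑ i, d i ≤ 0 := by simpa [← Fin.top_eq_last] using hd (Fin.last n)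
    have key := ih (w := fun i => w i.castSucc) (d := fun i => d i.castSucc)
      (fun i j hij => hw (Fin.castSucc_le_castSucc_iff.2 hij))
      (fun j => by simpa only [Fin.sum_Iic_castSucc] using hd j.castSucc)
      (c := w (Fin.last n)) (fun i => hw (Fin.le_last _))
    calc c * ∑ i, d i ≤ w (Fin.last n) * ∑ i, d i := mul_le_mul_of_nonpos_right (hc _) hd0
      _ ≤ ∑ i, w i * d i := by
        rw [Fin.sum_univ_castSucc, Fin.sum_univ_castSucc, mul_add]
        exact add_le_add_left key _

theorem ascending_eq_comp_rev {x : Fin k → ℕ} (hx : Antitone x) : ascending x = x ∘ Fin.rev :=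
  (Tuple.comp_sort_eq_comp_iff_monotone (σ := Fin.revPerm)).2
    (fun _ _ hij => hx (Fin.rev_le_rev.2 hij)) |>.symm

theorem sum_ascending {M : Type*} [AddCommMonoid M] (x : Fin k → ℕ) (f : ℕ → M) :
    ∑ i, f (ascending x i) = ∑ i, f (x i) :=
  Equiv.sum_comp (Tuple.sort x) fun i => f (x i)

theorem monotone_ascending (x : Fin k → ℕ) : Monotone (ascending x) :=
  Tuple.monotone_sort x

/-- Strict convexity of `n ↦ t ^ n`: the graph lies strictly above its tangent line
at `b`, elsewhere than at `b`. This is `1 + x < exp x` for `x = (a - b) log t`. -/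
theorem tangent_lt_pow {t : ℝ} (h0 : 0 < t) (h1 : t < 1) {a b : ℕ} (hab : a ≠ b) :
    t ^ b * Real.log t * ((a : ℝ) - b) < t ^ a - t ^ b := by
  have hlog : Real.log t < 0 := Real.log_neg h0 h1
  have hne : Real.log t * ((a : ℝ) - b) ≠ 0 :=
    mul_ne_zero hlog.ne (sub_ne_zero.2 (Nat.cast_injective.ne hab))
  have hexp : t ^ b * Real.exp (Real.log t * ((a : ℝ) - b)) = t ^ a := by
    rw [← Real.rpow_def_of_pos h0, ← Real.rpow_natCast t b, ← Real.rpow_add h0,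
      add_sub_cancel, Real.rpow_natCast]
  have := mul_lt_mul_of_pos_left (Real.add_one_lt_exp hne) (pow_pos h0 b)
  rw [hexp] at this
  linarith

/-- Karamata's inequality for the strictly convex function `n ↦ t ^ n`. -/
theorem sum_pow_lt_of_majorizes {p q : Fin k → ℕ} (hp : Antitone p) (hq : Antitone q)
    (hpq : Majorizes q p) (hne : p ≠ q) {t : ℝ} (h0 : 0 < t) (h1 : t < 1) :
    ∑ i, t ^ p i < ∑ i, t ^ q i := by
  set a := ascending q with ha
  set b := ascending p with hb
  have hab : a ≠ b := fun h => hne <| by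
    rw [ha, hb, ascending_eq_comp_rev hq, ascending_eq_comp_rev hp] at h
    exact (Fin.rev_surjective.injective_comp_right h).symm
  have hw : Monotone fun i => t ^ b i * Real.log t := fun i j hij =>
    mul_le_mul_of_nonpos_right
      (pow_le_pow_of_le_one h0.le h1.le (monotone_ascending p hij)) (Real.log_neg h0 h1).le
  have hnn : 0 ≤ ∑ i, t ^ b i * Real.log t * ((a i : ℝ) - b i) := by
    have hsum : ∑ i, ((a i : ℝ) - b i) = 0 := by
      have h : ∑ i, a i = ∑ i, b i :=
        (sum_ascending q id).trans (hpq.2.trans (sum_ascending p id).symm)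
      rw [Finset.sum_sub_distrib, sub_eq_zero]
      exact_mod_cast h
    have h := mul_sum_le_sum_mul_of_monotone (c := 0) (d := fun i => (a i : ℝ) - b i) hw
      (fun j => ?_) (fun i => mul_nonpos_of_nonneg_of_nonpos (pow_nonneg h0.le _)
        (Real.log_neg h0 h1).le)
    · rwa [hsum, mul_zero] at h
    · rw [Finset.sum_sub_distrib, sub_nonpos]
      exact_mod_cast hpq.1 j
  have hlt : ∑ i, t ^ b i * Real.log t * ((a i : ℝ) - b i) < ∑ i, (t ^ a i - t ^ b i) := by
    obtain ⟨i, hi⟩ := Function.ne_iff.1 hab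
    refine Finset.sum_lt_sum (fun j _ => ?_) ⟨i, Finset.mem_univ i, tangent_lt_pow h0 h1 hi⟩
    rcases eq_or_ne (a j) (b j) with h | h
    · simp [h]
    · exact (tangent_lt_pow h0 h1 h).le
  rw [Finset.sum_sub_distrib, sum_ascending q (t ^ ·), sum_ascending p (t ^ ·)] at hlt
  linarith

theorem majorizes_minPartition {m : ℕ} (hk : 1 ≤ k) (hm : 2 * k ≤ m) (p : partitionSet m k) :
    Majorizes p.1 (minPartition m k hk hm).1 := by
  have htot : ∑ i, p.1 i = ∑ i, (minPartition m k hk hm).1 i :=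
    p.2.2.2.trans (minPartition m k hk hm).2.2.2.symm
  refine ⟨fun j => ?_, htot⟩
  set a := ascending p.1
  set b := ascending (minPartition m k hk hm).1
  have hb (i) : m / k ≤ b i ∧ b i ≤ m / k + 1 := by
    simp only [b, ascending, minPartition, Function.comp_apply]
    split_ifs <;> omega
  rcases le_or_gt (a j) (m / k) with hj | hj
  · -- All entries of `p` up to `j` are at most those of the balanced partition.
    refine Finset.sum_le_sum fun i hi => ?_
    exact (monotone_ascending p.1 (Finset.mem_Iic.1 hi)).trans (hj.trans (hb i).1)
  · -- All later entries of `p` are at least those of the balanced partition; compare the tails.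
    have htail : ∑ i ∈ (Finset.Iic j)ᶜ, b i ≤ ∑ i ∈ (Finset.Iic j)ᶜ, a i := by
      refine Finset.sum_le_sum fun i hi => ?_
      have hji : j ≤ i := by
        rw [Finset.mem_compl, Finset.mem_Iic, not_le] at hi
        exact hi.le
      exact (hb i).2.trans (lt_of_lt_of_le hj (monotone_ascending p.1 hji))
    have hta := Finset.sum_add_sum_compl (Finset.Iic j) a
    have htb := Finset.sum_add_sum_compl (Finset.Iic j) b
    have h1 : ∑ i, a i = ∑ i, p.1 i := sum_ascending p.1 id
    have h2 : ∑ i, b i = ∑ i, (minPartition m k hk hm).1 i := sum_ascending _ id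
    omega

theorem maxPartition_majorizes {m : ℕ} (hk : 1 ≤ k) (hm : 2 * k ≤ m) (p : partitionSet m k) :
    Majorizes (maxPartition m k hk hm).1 p.1 := by
  have htot : ∑ i, (maxPartition m k hk hm).1 i = ∑ i, p.1 i :=
    (maxPartition m k hk hm).2.2.2.trans p.2.2.2.symm
  refine ⟨fun j => ?_, htot⟩
  rcases eq_or_ne ((j : ℕ) + 1) k with hj | hj
  · have huniv : Finset.Iic j = Finset.univ := by
      ext i
      simp only [Finset.mem_Iic, Finset.mem_univ, iff_true, Fin.le_def]
      omega
    have h1 : ∑ i, ascending p.1 i = ∑ i, p.1 i := sum_ascending p.1 id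
    have h2 : ∑ i, ascending (maxPartition m k hk hm).1 i = ∑ i, (maxPartition m k hk hm).1 i :=
      sum_ascending _ id
    rw [huniv, h1, h2, htot]
  · -- In ascending order, all entries of the maximal partition but the last are `2`.
    refine Finset.sum_le_sum fun i hi => ?_
    have hi' : (i : ℕ) ≤ j := Fin.le_def.1 (Finset.mem_Iic.1 hi)
    have hrev : ((Fin.rev i : Fin k) : ℕ) ≠ 0 := by
      rw [Fin.val_rev]
      omega
    have h2 : (maxPartition m k hk hm).1 (Fin.rev i) = 2 := by
      simp only [maxPartition, if_neg hrev, mul_zero, zero_add]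
    rw [ascending_eq_comp_rev (maxPartition m k hk hm).2.1, Function.comp_apply, h2]
    exact p.2.2.1 _

end Majorization

/-! ### The characteristic equation of a rose digraph -/

section CharacteristicEquation

variable {m k : ℕ}

/-- The left-hand side of the characteristic equation `roseFun α p t = 1 - α` of a rose digraph,
written in the variable `t = (1 - α) / (ρ - α)`. -/
def roseFun (α : ℝ) (p : Fin k → ℕ) (t : ℝ) : ℝ :=
  (1 - α) * ∑ i, t ^ p i + α * (k - 1) * t

theorem roseFun_le_roseFun {α : ℝ} (h0 : 0 ≤ α) (h1 : α < 1) (hk : 1 ≤ k) (p : Fin k → ℕ)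
    {s t : ℝ} (hs : 0 ≤ s) (hst : s ≤ t) : roseFun α p s ≤ roseFun α p t := by
  have hk' : (0 : ℝ) ≤ k - 1 := sub_nonneg.2 (by exact_mod_cast hk)
  have hα : 0 ≤ 1 - α := (sub_pos.2 h1).le
  unfold roseFun
  gcongr

theorem exists_roseFun_eq {α : ℝ} (h1 : α < 1) (hk : 1 ≤ k) {p : Fin k → ℕ}
    (hp : ∀ i, 2 ≤ p i) : ∃ t : ℝ, 0 < t ∧ t ≤ 1 ∧ roseFun α p t = 1 - α := by
  have hk' : (0 : ℝ) ≤ k - 1 := sub_nonneg.2 (by exact_mod_cast hk)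
  have hzero : roseFun α p 0 = 0 := by
    simp [roseFun, fun i => (Nat.zero_lt_two.trans_le (hp i)).ne']
  have hone : 1 - α ≤ roseFun α p 1 := by
    simp only [roseFun, one_pow, Finset.sum_const, Finset.card_univ, Fintype.card_fin,
      nsmul_eq_mul, mul_one]
    linarith
  have hcont : ContinuousOn (roseFun α p) (Set.Icc 0 1) := by
    unfold roseFun
    fun_prop
  obtain ⟨t, ht, h⟩ := intermediate_value_Icc zero_le_one hcont
    (show 1 - α ∈ Set.Icc (roseFun α p 0) (roseFun α p 1) from
      ⟨by rw [hzero]; linarith, hone⟩)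
  refine ⟨t, lt_of_le_of_ne ht.1 fun h' => ?_, ht.2, h⟩
  rw [← h', hzero] at h
  linarith

end CharacteristicEquation

/-! ### The positive eigenvector of a rose digraph -/

section Eigenvector

variable {m k : ℕ} (p : partitionSet m k)

/-- The weight `t ^ (p i - a)` at the vertex `a` of the `i`-th cycle, with weight `1` at the
centre: the exponent is the distance to the centre. -/
def roseVector (t : ℝ) : CoalescenceVertex (basePoint p) → ℝ
  | none => 1
  | some ⟨i, a⟩ => t ^ (p.1 i - (a.1 : ℕ))

/-- The vertex following the centre on the `i`-th cycle. -/
def firstVertex (i : Fin k) : CoalescenceVertex (basePoint p) :=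
  some ⟨i, ⟨1, p.2.2.1 i⟩, fun h => one_ne_zero (congrArg Fin.val h)⟩

/-- The out-neighbour, on the `i`-th cycle, of the vertex `a` of this cycle. -/
def nextVertex (i : Fin k) (a : Fin (p.1 i)) : CoalescenceVertex (basePoint p) :=
  toCoalescence (basePoint p) i
    ⟨((a : ℕ) + 1) % p.1 i, Nat.mod_lt _ (Nat.zero_lt_two.trans_le (p.2.2.1 i))⟩

variable {p}

theorem toCoalescence_eq_none_iff {i : Fin k} {a : Fin (p.1 i)} :
    toCoalescence (basePoint p) i a = none ↔ a = basePoint p i := by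
  unfold toCoalescence
  split_ifs with h <;> simp [h]

theorem toCoalescence_eq_some_iff {i j : Fin k} {a : Fin (p.1 i)}
    {b : {b : Fin (p.1 j) // b ≠ basePoint p j}} :
    toCoalescence (basePoint p) i a = some ⟨j, b⟩ ↔
      (⟨i, a⟩ : Σ i, Fin (p.1 i)) = ⟨j, b.1⟩ := by
  unfold toCoalescence
  constructor
  · split_ifs with h
    · simp
    · intro h'
      exact congrArg (fun x : Σ j, {b : Fin (p.1 j) // b ≠ basePoint p j} =>
        (⟨x.1, x.2.1⟩ : Σ j, Fin (p.1 j))) (Option.some.inj h')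
  · obtain ⟨b, hb⟩ := b
    rintro ⟨⟩
    rw [dif_neg hb]

theorem rose_adj_iff {x y : CoalescenceVertex (basePoint p)} :
    (rose p).Adj x y ↔
      ∃ i a, toCoalescence (basePoint p) i a = x ∧ nextVertex p i a = y := by
  constructor
  · rintro ⟨i, a, b, hab, rfl, rfl⟩
    refine ⟨i, a, rfl, congrArg (toCoalescence (basePoint p) i) (Fin.ext ?_)⟩
    exact hab.symm
  · rintro ⟨i, a, rfl, rfl⟩
    exact ⟨i, a, ⟨((a : ℕ) + 1) % p.1 i, _⟩, (rfl : _ % _ = _ % _), rfl, rfl⟩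

theorem nextVertex_basePoint (i : Fin k) : nextVertex p i (basePoint p i) = firstVertex p i := by
  rw [nextVertex, firstVertex, toCoalescence_eq_some_iff]
  congr
  exact Nat.mod_eq_of_lt (p.2.2.1 i)

theorem rose_adj_none_iff {y : CoalescenceVertex (basePoint p)} :
    (rose p).Adj none y ↔ ∃ i, firstVertex p i = y := by
  rw [rose_adj_iff]
  constructor
  · rintro ⟨i, a, ha, rfl⟩
    rw [toCoalescence_eq_none_iff.1 ha]
    exact ⟨i, (nextVertex_basePoint i).symm⟩
  · rintro ⟨i, rfl⟩
    exact ⟨i, _, toCoalescence_eq_none_iff.2 rfl, nextVertex_basePoint i⟩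

theorem rose_adj_some_iff {i : Fin k} {a : {a : Fin (p.1 i) // a ≠ basePoint p i}}
    {y : CoalescenceVertex (basePoint p)} :
    (rose p).Adj (some ⟨i, a⟩) y ↔ y = nextVertex p i a.1 := by
  rw [rose_adj_iff]
  constructor
  · rintro ⟨j, b, hb, rfl⟩
    cases toCoalescence_eq_some_iff.1 hb
    rfl
  · rintro rfl
    exact ⟨i, a.1, toCoalescence_eq_some_iff.2 rfl, rfl⟩

theorem firstVertex_injective : Function.Injective (firstVertex p) := fun _ _ h =>
  congrArg Sigma.fst (Option.some.inj h)

theorem roseVector_nextVertex (t : ℝ) (i : Fin k) (a : Fin (p.1 i)) :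
    roseVector p t (nextVertex p i a) = t ^ (p.1 i - ((a : ℕ) + 1)) := by
  have ha := a.2
  unfold nextVertex toCoalescence
  rcases eq_or_ne ((a : ℕ) + 1) (p.1 i) with h | h
  · rw [dif_pos (Fin.ext (by simp [basePoint, h])), h, Nat.sub_self, pow_zero]
    rfl
  · have hmod : ((a : ℕ) + 1) % p.1 i = (a : ℕ) + 1 := Nat.mod_eq_of_lt (by omega)
    rw [dif_neg (fun h' => by
      have := congrArg Fin.val h'
      simp [basePoint, hmod] at this)]
    simp only [roseVector, hmod]

theorem roseVector_pos {t : ℝ} (ht : 0 < t) (x : CoalescenceVertex (basePoint p)) :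
    0 < roseVector p t x := by
  rcases x with _ | ⟨i, a⟩
  · exact one_pos
  · exact pow_pos ht _

theorem alphaMatrix_mulVec_roseVector {α t : ℝ} (ht : 0 < t) (h : roseFun α p.1 t = 1 - α) :
    (alphaMatrix α (rose p)).mulVec (roseVector p t) = (α + (1 - α) / t) • roseVector p t := by
  ext x
  rw [Pi.smul_apply, smul_eq_mul]
  rcases x with _ | ⟨i, a⟩
  · rw [alphaMatrix_mulVec α (rose p) _ _ (Finset.univ.map ⟨firstVertex p, firstVertex_injective⟩)
      (by simp [rose_adj_none_iff])]
    have hsum : ∑ i, t ^ p.1 i = t * ∑ i, roseVector p t (firstVertex p i) := by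
      rw [Finset.mul_sum]
      refine Finset.sum_congr rfl fun i _ => ?_
      have h2 := p.2.2.1 i
      rw [← nextVertex_basePoint, roseVector_nextVertex, ← pow_succ']
      congr 1
      simp only [basePoint]
      omega
    rw [roseFun, hsum] at h
    rw [Finset.card_map, Finset.card_univ, Fintype.card_fin, Finset.sum_map]
    simp only [Function.Embedding.coeFn_mk, roseVector, mul_one]
    field_simp
    simp only [roseVector] at h
    linarith
  · rw [alphaMatrix_mulVec α (rose p) _ _ {nextVertex p i a.1} (by simp [rose_adj_some_iff])]
    have hexp : t ^ (p.1 i - (a.1 : ℕ)) = t * t ^ (p.1 i - ((a.1 : ℕ) + 1)) := by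
      have := a.1.2
      rw [← pow_succ']
      congr 1
      omega
    rw [Finset.sum_singleton, roseVector_nextVertex, Finset.card_singleton]
    simp only [roseVector, hexp]
    field_simp
    push_cast
    ring

theorem alphaSpectralRadius_rose {α t : ℝ} (h0 : 0 ≤ α) (h1 : α < 1) (ht : 0 < t)
    (h : roseFun α p.1 t = 1 - α) : alphaSpectralRadius α (rose p) = α + (1 - α) / t :=
  spectralRadius_eq_of_pos_eigenvector (alphaMatrix_nonneg h0 h1.le _) (roseVector_pos ht)
    (alphaMatrix_mulVec_roseVector ht h)

theorem alphaSpectralRadius_rose_lt {α : ℝ} (h0 : 0 ≤ α) (h1 : α < 1) {p q : partitionSet m k}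
    (hpq : Majorizes q.1 p.1) (hne : p ≠ q) :
    alphaSpectralRadius α (rose p) < alphaSpectralRadius α (rose q) := by
  have hα : 0 < 1 - α := sub_pos.2 h1
  have hne' : p.1 ≠ q.1 := fun h => hne (Subtype.ext h)
  -- For `k ≤ 1` there is at most one partition.
  have hk : 2 ≤ k := by
    by_contra! hk
    refine hne' (funext fun i => ?_)
    have huniv (j : Fin k) : j = i := Fin.ext (by omega)
    have hp : ∑ j, p.1 j = p.1 i := Fintype.sum_eq_single i fun j hj => absurd (huniv j) hj
    have hq : ∑ j, q.1 j = q.1 i := Fintype.sum_eq_single i fun j hj => absurd (huniv j) hj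
    rw [← hp, ← hq, p.2.2.2, q.2.2.2]
  have hk2 : (2 : ℝ) ≤ k := by exact_mod_cast hk
  obtain ⟨s, hs0, hs1, hs⟩ := exists_roseFun_eq h1 (one_le_two.trans hk) p.2.2.1
  obtain ⟨t, ht0, -, ht⟩ := exists_roseFun_eq h1 (one_le_two.trans hk) q.2.2.1
  have hs1' : s < 1 := by
    refine lt_of_le_of_ne hs1 fun h => ?_
    rw [h] at hs
    simp only [roseFun, one_pow, Finset.sum_const, Finset.card_univ, Fintype.card_fin,
      nsmul_eq_mul, mul_one] at hs
    linarith
  have hlt : roseFun α p.1 s < roseFun α q.1 s := by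
    have := mul_lt_mul_of_pos_left
      (sum_pow_lt_of_majorizes p.2.1 q.2.1 hpq hne' hs0 hs1') hα
    unfold roseFun
    linarith
  have hts : t < s := by
    by_contra! hst
    have := roseFun_le_roseFun h0 h1 (one_le_two.trans hk) q.1 hs0.le hst
    linarith
  rw [alphaSpectralRadius_rose h0 h1 hs0 hs, alphaSpectralRadius_rose h0 h1 ht0 ht]
  gcongr

end Eigenvector

end RoseDigraph

theorem mainTheorem1 (α : ℝ) (hα0 : 0 ≤ α) (hα1 : α < 1) (m k : ℕ) :
    (∀ p q : RoseDigraph.partitionSet m k,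
      RoseDigraph.Majorizes q.1 p.1 → p ≠ q →
        RoseDigraph.alphaSpectralRadius α (RoseDigraph.rose p) <
          RoseDigraph.alphaSpectralRadius α (RoseDigraph.rose q)) ∧
    ∀ (hk : 1 ≤ k) (hm : 2 * k ≤ m),
      (∀ p : RoseDigraph.partitionSet m k,
        RoseDigraph.Majorizes (RoseDigraph.maxPartition m k hk hm).1 p.1 ∧
        RoseDigraph.Majorizes p.1 (RoseDigraph.minPartition m k hk hm).1) ∧
      ∀ (V : Type*) [Fintype V] [DecidableEq V] (G : Digraph V), RoseDigraph.IsRose m k G →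
        (RoseDigraph.alphaSpectralRadius α G ≤
            RoseDigraph.alphaSpectralRadius α
              (RoseDigraph.rose (RoseDigraph.maxPartition m k hk hm)) ∧
          (RoseDigraph.alphaSpectralRadius α G =
              RoseDigraph.alphaSpectralRadius α
                (RoseDigraph.rose (RoseDigraph.maxPartition m k hk hm)) ↔
            RoseDigraph.IsIsomorphic G
              (RoseDigraph.rose (RoseDigraph.maxPartition m k hk hm)))) ∧
        (RoseDigraph.alphaSpectralRadius α
              (RoseDigraph.rose (RoseDigraph.minPartition m k hk hm)) ≤
            RoseDigraph.alphaSpectralRadius α G ∧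
          (RoseDigraph.alphaSpectralRadius α G =
              RoseDigraph.alphaSpectralRadius α
                (RoseDigraph.rose (RoseDigraph.minPartition m k hk hm)) ↔
            RoseDigraph.IsIsomorphic G
              (RoseDigraph.rose (RoseDigraph.minPartition m k hk hm)))) := by
  refine ⟨fun p q hpq hne => RoseDigraph.alphaSpectralRadius_rose_lt hα0 hα1 hpq hne,
    fun hk hm => ⟨fun p => ⟨RoseDigraph.maxPartition_majorizes hk hm p,
      RoseDigraph.majorizes_minPartition hk hm p⟩, ?_⟩⟩
  rintro V _ _ G ⟨p, hG⟩
  have hρ := RoseDigraph.alphaSpectralRadius_eq_of_isIsomorphic α hG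
  refine ⟨?_, ?_⟩
  · by_cases hp : p = RoseDigraph.maxPartition m k hk hm
    · subst hp
      exact ⟨hρ.le, iff_of_true hρ hG⟩
    · have hlt := RoseDigraph.alphaSpectralRadius_rose_lt hα0 hα1
        (RoseDigraph.maxPartition_majorizes hk hm p) hp
      rw [← hρ] at hlt
      exact ⟨hlt.le, fun h => absurd h hlt.ne,
        RoseDigraph.alphaSpectralRadius_eq_of_isIsomorphic α⟩
  · by_cases hp : p = RoseDigraph.minPartition m k hk hm
    · subst hp
      exact ⟨hρ.ge, iff_of_true hρ hG⟩
    · have hlt := RoseDigraph.alphaSpectralRadius_rose_lt hα0 hα1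
        (RoseDigraph.majorizes_minPartition hk hm p) (Ne.symm hp)
      rw [← hρ] at hlt
      exact ⟨hlt.le, fun h => absurd h hlt.ne',
        RoseDigraph.alphaSpectralRadius_eq_of_isIsomorphic α⟩
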